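/- Let $n\ge 1$, let $p\ne 2$ be a real number, and let $F\subset \mathrm{Sym}(\mathbb R^n)$ be a cone subequation, i.e. $F$ is closed, $F+P\subset F$ for every nonnegative form $P$, and $tF\subset F$ for all $t>0$. Its dual is $\widetilde F=-(\mathrm{Sym}(\mathbb R^n)\setminus \mathrm{Int}\,F)$. A function $u:\Omega\to[-\infty,\infty)$ on an open set $\Omega\subset\mathbb R^n$ is *$F$-subharmonic* if it is upper semicontinuous and, whenever $x\in\Omega$ and $\varphi$ is a real function of class $C^2$ near $x$ with $u\le\varphi$ near $x$ and $u(x)=\varphi(x)$, one has $D^2_x\varphi\in F$. It is *$F$-harmonic* if $u$ is $F$-subharmonic and $-u$ is $\widetilde F$-subharmonic. On the unit sphere $S^{n-1}$ let $J^2(S^{n-1})$ be the bundle of riemannian 2-jets $J^2_\sigma\psi=(\psi(\sigma),D_\sigma\psi,\mathrm{Hess}_\sigma\psi)$. For a subset $G\subset J^2(S^{n-1})$, a function $g:S^{n-1}\to[-\infty,\infty)$ is *$G$-subharmonic* if it is upper semicontinuous and, whenever $\sigma\in S^{n-1}$ and $\psi$ is a real function of class $C^2$ near $\sigma$ with $g\le\psi$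 near $\sigma$ and $g(\sigma)=\psi(\sigma)$, one has $J^2_\sigma\psi\in G$. With $\widetilde G=-(J^2(S^{n-1})\setminus\mathrm{Int}\,G)$ (the minus sign acting in the fibres), $g$ is *$G$-harmonic* if $g$ is $G$-subharmonic and $-g$ is $\widetilde G$-subharmonic. Regarding $D_\sigma\psi$ as a vector orthogonal to $\sigma$ and $\mathrm{Hess}_\sigma\psi$ as a form on $\mathbb R^n$ whose null space contains $\sigma$, put $$\Phi(J^2_\sigma\psi)=\mathrm{Hess}_\sigma\psi-(p-2)\psi(\sigma)P_{\sigma^\perp}-(p-1)\,\sigma\circ D_\sigma\psi+(p-2)(p-1)\psi(\sigma)P_\sigma\in\mathrm{Sym}(\mathbb R^n),$$ where $P_\sigma$ and $P_{\sigma^\perp}$ are the orthogonal projections onto $\mathbb R\sigma$ and $\sigma^\perp$, and $a\circ b=a\otimes b+b\otimes a$. For $H\subset\mathrm{Sym}(\mathbb R^n)$ let $H_{S^{n-1}}=\Phi^{-1}(H)\subset J^2(S^{n-1})$. **Theorem.** Let $u:\mathbb R^n\setminus\{0\}\to[-\infty,\infty)$ and $g:S^{n-1}\to[-\infty,\infty)$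 be upper semicontinuous functions related by $u(x)=|x|^{2-p}\,g(x/|x|)$. Then: 1. $u$ is $F$-subharmonic on $\mathbb R^n\setminus\{0\}$ if and only if $g$ is $F_{S^{n-1}}$-subharmonic on $S^{n-1}$. 2. $u$ is $F$-harmonic on $\mathbb R^n\setminus\{0\}$ if and only if $g$ is $F_{S^{n-1}}$-subharmonic and $-g$ is $(\widetilde F)_{S^{n-1}}$-subharmonic on $S^{n-1}$. 3. If $g$ is $F_{S^{n-1}}$-harmonic on $S^{n-1}$, then $u$ is $F$-harmonic on $\mathbb R^n\setminus\{0\}$; and if $p\ne1$, then, conversely, $g$ is $F_{S^{n-1}}$-harmonic on $S^{n-1}$ whenever $u$ is $F$-harmonic on $\mathbb R^n\setminus\{0\}$. -/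

import Mathlib

open scoped Manifold ContDiff Topology

noncomputable section

namespace HomogeneousSubharmonics

/-- The Euclidean space `ℝⁿ` with `n = d + 1`. -/
abbrev E (d : ℕ) := EuclideanSpace ℝ (Fin (d + 1))

/-- The unit sphere `S^{n-1}` of `ℝⁿ`, `n = d + 1`, a manifold of dimension `d`. -/
abbrev S (d : ℕ) := Metric.sphere (0 : E d) 1

/-- `Sym(ℝⁿ)`: the real vector space of symmetric (self-adjoint) endomorphisms of `ℝⁿ`, which are
identified with the quadratic forms `v ↦ ⟨A v, v⟩`. -/
abbrev Sym (d : ℕ) := selfAdjoint (E d →L[ℝ] E d)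

/-- A cone subequation: a closed subset `F` of `Sym(ℝⁿ)` with `F + P ⊆ F`, where `P` is the set of
nonnegative elements, and `t F ⊆ F` for `t > 0`. -/
structure IsConeSubequation {d : ℕ} (F : Set (Sym d)) : Prop where
  isClosed : IsClosed F
  positivity : ∀ A ∈ F, ∀ P : Sym d, (P : E d →L[ℝ] E d).IsPositive → A + P ∈ F
  cone : ∀ A ∈ F, ∀ t : ℝ, 0 < t → t • A ∈ F

/-- The (Dirichlet) dual `- (∁ Int F)`. -/
def dual {d : ℕ} (F : Set (Sym d)) : Set (Sym d) := {A | -A ∉ interior F}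

/-- `u` is `F`-subharmonic on `Ω` in the viscosity sense: `u` is upper semicontinuous on `Ω` with
values in `[-∞, ∞)`, and for every `x ∈ Ω` and every function `φ`, of class `C²` near `x`, with
`u ≤ φ` near `x` and `u(x) = φ(x)`, the second derivative `D²φ(x)` belongs to `F`. -/
def IsSubharmonicOn {d : ℕ} (F : Set (Sym d)) (Ω : Set (E d)) (u : E d → EReal) : Prop :=
  UpperSemicontinuousOn u Ω ∧ (∀ x ∈ Ω, u x ≠ ⊤) ∧
    ∀ x ∈ Ω, ∀ φ : E d → ℝ, ContDiffAt ℝ 2 φ x →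
      (∀ᶠ y in 𝓝 x, u y ≤ (φ y : EReal)) → u x = (φ x : EReal) →
        ∃ A ∈ F, ∀ v w, inner ℝ ((A : E d →L[ℝ] E d) v) w = fderiv ℝ (fderiv ℝ φ) x v w

/-- `u` is `F`-harmonic: `u` is `F`-subharmonic and `-u` is subharmonic for the dual of `F`. -/
def IsHarmonicOn {d : ℕ} (F : Set (Sym d)) (Ω : Set (E d)) (u : E d → EReal) : Prop :=
  IsSubharmonicOn F Ω u ∧ IsSubharmonicOn (dual F) Ω (fun x => -u x)

/-- The total space of the riemannian 2-jet bundle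
`J²(S^{n-1}) = ℝ × T* S^{n-1} × Sym²(T* S^{n-1})`. A point is a quadruple `(σ, r, q, A)`, where
cotangent vectors at `σ` are regarded as vectors `q` of `ℝⁿ` orthogonal to `σ`, and symmetric forms
on `T_σ S^{n-1}` as elements `A` of `Sym(ℝⁿ)` having `σ` in their null space. The topology is
the one induced from the product, that is, the usual topology of the bundle. -/
abbrev SphereJet (d : ℕ) :=
  {J : S d × ℝ × E d × Sym d //
    inner ℝ (J.1 : E d) J.2.2.1 = 0 ∧ (J.2.2.2 : E d →L[ℝ] E d) (J.1 : E d) = 0}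

namespace SphereJet

/-- The base point. -/
def pt {d : ℕ} (J : SphereJet d) : S d := J.1.1

/-- The value. -/
def val {d : ℕ} (J : SphereJet d) : ℝ := J.1.2.1

/-- The first-order part, as a vector of `ℝⁿ` orthogonal to the base point. -/
def grad {d : ℕ} (J : SphereJet d) : E d := J.1.2.2.1

/-- The second-order part, as an element of `Sym(ℝⁿ)` with the base point in its null space. -/
def hess {d : ℕ} (J : SphereJet d) : Sym d := J.1.2.2.2

/-- The negative of a jet, in its fibre. -/
def neg {d : ℕ} (J : SphereJet d) : SphereJet d :=
  ⟨(J.pt, -J.val, -J.grad, -J.hess), by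
    refine ⟨?_, ?_⟩
    · have h : inner ℝ (J.pt : E d) J.grad = 0 := J.2.1
      show inner ℝ (J.pt : E d) (-J.grad) = 0
      rw [inner_neg_right, h, neg_zero]
    · have h : (J.hess : E d →L[ℝ] E d) (J.pt : E d) = 0 := J.2.2
      show -((J.hess : E d →L[ℝ] E d) (J.pt : E d)) = 0
      rw [h, neg_zero]⟩

end SphereJet

/-- The unit speed geodesic `t ↦ cos t σ + sin t v` of the sphere, starting at `σ` in the direction
of the unit tangent vector `v`. -/
def geodesic {d : ℕ} (σ : S d) (v : E d) (hv : ‖v‖ = 1) (hσv : inner ℝ (σ : E d) v = 0) (t : ℝ) :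
    S d :=
  ⟨Real.cos t • (σ : E d) + Real.sin t • v, by
    have hσ : ‖(σ : E d)‖ = 1 := norm_eq_of_mem_sphere σ
    have h : ‖Real.cos t • (σ : E d) + Real.sin t • v‖ ^ 2 = 1 := by
      rw [norm_add_sq_real, norm_smul, norm_smul, hσ, hv, inner_smul_left, inner_smul_right, hσv]
      simp
    rw [mem_sphere_zero_iff_norm]
    nlinarith [norm_nonneg (Real.cos t • (σ : E d) + Real.sin t • v)]⟩

/-- `J` is the riemannian 2-jet `(ψ(σ), Dψ(σ), Hess ψ(σ))` of `ψ` at `σ`: along every unit speed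
geodesic `γ` from `σ` with initial velocity `v`, one has `Dψ(v) = (ψ ∘ γ)'(0)` and
`Hess ψ(v, v) = (ψ ∘ γ)''(0)`. By homogeneity and polarization, this determines `J`. -/
def IsTwoJetAt {d : ℕ} (ψ : S d → ℝ) (σ : S d) (J : SphereJet d) : Prop :=
  J.pt = σ ∧ J.val = ψ σ ∧
    ∀ (v : E d) (hv : ‖v‖ = 1) (hσv : inner ℝ (σ : E d) v = 0),
      inner ℝ J.grad v = deriv (fun t => ψ (geodesic σ v hv hσv t)) 0 ∧
      inner ℝ ((J.hess : E d →L[ℝ] E d) v) v =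
        iteratedDeriv 2 (fun t => ψ (geodesic σ v hv hσv t)) 0

/-- `g` is subharmonic on the sphere for a subset `G` of the 2-jet bundle, in the viscosity sense:
`g` is upper semicontinuous with values in `[-∞, ∞)`, and for every `σ` and every function `ψ`, of
class `C²` near `σ`, with `g ≤ ψ` near `σ` and `g(σ) = ψ(σ)`, the 2-jet of `ψ` at `σ` belongs
to `G`. -/
def IsSphereSubharmonic {d : ℕ} (G : Set (SphereJet d)) (g : S d → EReal) : Prop :=
  UpperSemicontinuous g ∧ (∀ σ, g σ ≠ ⊤) ∧
    ∀ (σ : S d) (ψ : S d → ℝ), ContMDiffAt (𝓡 d) 𝓘(ℝ, ℝ) 2 ψ σ →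
      (∀ᶠ τ in 𝓝 σ, g τ ≤ (ψ τ : EReal)) → g σ = (ψ σ : EReal) →
        ∃ J ∈ G, IsTwoJetAt ψ σ J

/-- The (Dirichlet) dual `- (∁ Int G)` of a subset `G` of the 2-jet bundle. -/
def jetDual {d : ℕ} (G : Set (SphereJet d)) : Set (SphereJet d) := {J | J.neg ∉ interior G}

/-- `g` is `G`-harmonic on the sphere: `g` is `G`-subharmonic and `-g` is subharmonic for the dual
of `G`. -/
def IsSphereHarmonic {d : ℕ} (G : Set (SphereJet d)) (g : S d → EReal) : Prop :=
  IsSphereSubharmonic G g ∧ IsSphereSubharmonic (jetDual G) (fun σ => -g σ)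

/-- The symmetric product `a ∘ b = a ⊗ b + b ⊗ a`, that is, `v ↦ ⟨b, v⟩ a + ⟨a, v⟩ b`. -/
def symProd {d : ℕ} (a b : E d) : Sym d :=
  ⟨InnerProductSpace.rankOne ℝ a b + InnerProductSpace.rankOne ℝ b a, by
    rw [selfAdjoint.mem_iff, star_add]
    simp only [ContinuousLinearMap.star_eq_adjoint, InnerProductSpace.adjoint_rankOne]
    exact add_comm _ _⟩

/-- The orthogonal projection `P_σ` onto the line `ℝσ` spanned by a unit vector, `v ↦ ⟨σ, v⟩ σ`. -/
def lineProj {d : ℕ} (σ : S d) : Sym d :=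
  ⟨InnerProductSpace.rankOne ℝ (σ : E d) (σ : E d), by
    rw [selfAdjoint.mem_iff, ContinuousLinearMap.star_eq_adjoint,
      InnerProductSpace.adjoint_rankOne]⟩

/-- The map `Φ(σ, r, q, A) = A - (p-2) r P_{σ^⊥} - (p-1) σ ∘ q + (p-2)(p-1) r P_σ`, where
`P_{σ^⊥} = I - P_σ`. In blocks for `ℝⁿ = T_σ S^{n-1} ⊕ ℝσ`, the diagonal entries are
`A - (p-2) r I` and `(p-2)(p-1) r`, and the off-diagonal entries are `-(p-1) q`. -/
def Phi {d : ℕ} (p : ℝ) (J : SphereJet d) : Sym d :=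
  J.hess - ((p - 2) * J.val) • (1 - lineProj J.pt) - (p - 1) • symProd (J.pt : E d) J.grad
    + ((p - 2) * (p - 1) * J.val) • lineProj J.pt

/-- The pulled-back jet subequation `F_{S^{n-1}} = Φ⁻¹(F)`. -/
def onSphere {d : ℕ} (p : ℝ) (F : Set (Sym d)) : Set (SphereJet d) := Phi p ⁻¹' F

/-- The radial projection `x ↦ x / |x|`. -/
def radialProj {d : ℕ} (x : E d) (hx : x ≠ 0) : S d :=
  ⟨‖x‖⁻¹ • x, by
    rw [mem_sphere_zero_iff_norm, norm_smul, norm_inv, norm_norm]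
    exact inv_mul_cancel₀ (norm_ne_zero_iff.mpr hx)⟩

end HomogeneousSubharmonics

end

open HomogeneousSubharmonics

namespace HomogeneousSubharmonics

/-! From `u` to `g`: a test function `ψ` for `g` at `σ` extends to `φ(x) = |x|^(2-p) ψ(x/|x|)`,
which touches `u` at `σ`. Euler's relations for `φ` and a computation along geodesics show that its
second derivative at `σ` is `Φ` of the 2-jet of `ψ` (`exists_isTwoJetAt`).

From `g` to `u`: a test function `φ` for `u` need not be homogeneous. The cone property reduces to a
contact point `σ` on the sphere. There, touching along the ray forces the first-order Euler relation
and `c := D²φ(σ,σ) - (p-2)(p-1)φ(σ) ≥ 0` (`radial_derivs_of_le`). Restricting `φ` to a hypersurface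
`τ ↦ f(τ)τ` with `f = 1 + ⟨a,·⟩`, `a ⊥ σ`, and rescaling by `f^(p-2)` gives a test function for `g`,
whose Hessian is quadratic in `a`. If `c > 0`, completing the square gives an `a` for which `D²φ -
Φ(J)` is `c⁻¹` times the square of a linear form, so `D²φ ∈ F` by positivity
(`mem_of_touching_of_lt`). If `c = 0`, a quadratic perturbation and the closedness of `F` finish
(`mem_of_touching`).

The harmonic statements apply this to `-u` and the dual cone subequation. Comparing the two duals on
the sphere is topological: continuity of `Φ` gives one inclusion, and a continuous inverse on each
fibre, available for `p ≠ 1, 2`, gives the other (`jetDual_onSphere`). -/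

/-! ### Calculus along curves. -/

theorem deriv_and_iteratedDeriv_two {h h' : ℝ → ℝ} {a b : ℝ}
    (h₁ : ∀ᶠ t in 𝓝 a, HasDerivAt h (h' t) t) (h₂ : HasDerivAt h' b a) :
    deriv h a = h' a ∧ iteratedDeriv 2 h a = b := by
  refine ⟨h₁.self_of_nhds.deriv, ?_⟩
  have he : deriv h =ᶠ[𝓝 a] h' := h₁.mono fun t ht => ht.deriv
  rw [iteratedDeriv_succ, iteratedDeriv_one, he.deriv_eq, h₂.deriv]

/-- The first and second order necessary conditions at a local minimum. -/
theorem deriv_eq_zero_and_nonneg_of_isLocalMin {h h' : ℝ → ℝ} {a b : ℝ} (hm : IsLocalMin h a)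
    (h₁ : ∀ᶠ t in 𝓝 a, HasDerivAt h (h' t) t) (h₂ : HasDerivAt h' b a) :
    h' a = 0 ∧ 0 ≤ b := by
  have h0 : h' a = 0 := hm.hasDerivAt_eq_zero h₁.self_of_nhds
  refine ⟨h0, ?_⟩
  by_contra! hb
  have he : deriv h =ᶠ[𝓝 a] h' := h₁.mono fun t ht => ht.deriv
  have hdd : deriv (deriv h) a = b := by rw [he.deriv_eq, h₂.deriv]
  -- If `b < 0`, the point is also a local maximum, so `h` is locally constant and `b = 0`.
  have hM : IsLocalMax h a := isLocalMax_of_deriv_deriv_neg (by rw [hdd]; exact hb)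
    (by rw [he.self_of_nhds, h0]) h₁.self_of_nhds.continuousAt
  have hc : h =ᶠ[𝓝 a] fun _ => h a := by
    filter_upwards [hm, hM] with t h1 h2 using le_antisymm h2 h1
  have hd : deriv h =ᶠ[𝓝 a] fun _ => (0 : ℝ) := by
    filter_upwards [hc.eventuallyEq_nhds] with t ht
    rw [ht.deriv_eq, deriv_const]
  have : deriv (deriv h) a = 0 := by rw [hd.deriv_eq, deriv_const]
  linarith

section Curves

variable {V : Type*} [NormedAddCommGroup V] [NormedSpace ℝ V]

theorem hasDerivAt_comp_curve {φ : V → ℝ} {x x' : ℝ → V} {x'' : V} {a : ℝ}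
    (hφ : ContDiffAt ℝ 2 φ (x a)) (hx : ∀ t, HasDerivAt x (x' t) t)
    (hx' : HasDerivAt x' x'' a) :
    (∀ᶠ t in 𝓝 a, HasDerivAt (fun s => φ (x s)) (fderiv ℝ φ (x t) (x' t)) t) ∧
      HasDerivAt (fun t => fderiv ℝ φ (x t) (x' t))
        (fderiv ℝ (fderiv ℝ φ) (x a) (x' a) (x' a) + fderiv ℝ φ (x a) x'') a := by
  constructor
  · have h1 : ∀ᶠ y in 𝓝 (x a), ContDiffAt ℝ 2 φ y := hφ.eventually (by simp)
    filter_upwards [(hx a).continuousAt.eventually h1] with t ht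
    exact (ht.differentiableAt (by simp)).hasFDerivAt.comp_hasDerivAt t (hx t)
  · have h2 : ContDiffAt ℝ 1 (fderiv ℝ φ) (x a) := hφ.fderiv_right (by norm_num)
    exact ((h2.differentiableAt (by simp)).hasFDerivAt.comp_hasDerivAt a (hx a)).clm_apply hx'

theorem derivs_mul_comp_curve {φ : V → ℝ} {x x' : ℝ → V} {x'' : V} {w w' : ℝ → ℝ} {w'' a : ℝ}
    (hφ : ContDiffAt ℝ 2 φ (x a)) (hx : ∀ t, HasDerivAt x (x' t) t)
    (hx' : HasDerivAt x' x'' a) (hw : ∀ᶠ t in 𝓝 a, HasDerivAt w (w' t) t)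
    (hw' : HasDerivAt w' w'' a) :
    deriv (fun s => w s * φ (x s)) a = w' a * φ (x a) + w a * fderiv ℝ φ (x a) (x' a) ∧
      iteratedDeriv 2 (fun s => w s * φ (x s)) a =
        w'' * φ (x a) + 2 * (w' a * fderiv ℝ φ (x a) (x' a)) +
          w a * (fderiv ℝ (fderiv ℝ φ) (x a) (x' a) (x' a) + fderiv ℝ φ (x a) x'') := by
  obtain ⟨h1, h2⟩ := hasDerivAt_comp_curve hφ hx hx'
  have h := deriv_and_iteratedDeriv_two (h := fun s => w s * φ (x s))
    (h' := fun t => w' t * φ (x t) + w t * fderiv ℝ φ (x t) (x' t))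
    (by filter_upwards [h1, hw] with t ht hwt using hwt.mul ht)
    ((hw'.mul h1.self_of_nhds).add (hw.self_of_nhds.mul h2))
  exact ⟨h.1, by rw [h.2]; ring⟩

/-- If `φ` touches the homogeneous function `t ↦ t^(2-p) φ(σ)` from above along the ray through
`σ`, then its radial derivatives at `σ` satisfy the corresponding first and second order
conditions. -/
theorem radial_derivs_of_le {φ : V → ℝ} {σ : V} {p : ℝ} (hφ : ContDiffAt ℝ 2 φ σ)
    (h : ∀ᶠ t : ℝ in 𝓝 1, t ^ (2 - p) * φ σ ≤ φ (t • σ)) :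
    fderiv ℝ φ σ σ = (2 - p) * φ σ ∧
      (2 - p) * (1 - p) * φ σ ≤ fderiv ℝ (fderiv ℝ φ) σ σ σ := by
  have hx : ∀ t : ℝ, HasDerivAt (fun t : ℝ => t • σ) σ t := fun t => by
    simpa using (hasDerivAt_id t).smul_const σ
  obtain ⟨h1, h2⟩ := hasDerivAt_comp_curve (x := fun t : ℝ => t • σ) (a := 1)
    (x' := fun _ => σ) (φ := φ) (by simpa using hφ) hx (hasDerivAt_const _ _)
  have hpos : ∀ᶠ t : ℝ in 𝓝 1, 0 < t := lt_mem_nhds one_pos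
  have hw : ∀ᶠ t : ℝ in 𝓝 1, HasDerivAt (fun t : ℝ => t ^ (2 - p)) ((2 - p) * t ^ (1 - p)) t := by
    filter_upwards [hpos] with t ht
    convert Real.hasDerivAt_rpow_const (p := 2 - p) (Or.inl ht.ne') using 2
    ring_nf
  have hw' : HasDerivAt (fun t : ℝ => (2 - p) * t ^ (1 - p)) ((2 - p) * (1 - p)) 1 := by
    simpa using (Real.hasDerivAt_rpow_const (x := 1) (p := 1 - p) (Or.inl one_ne_zero)).const_mul
      (2 - p)
  have hm : IsLocalMin (fun t : ℝ => φ (t • σ) - t ^ (2 - p) * φ σ) 1 := by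
    filter_upwards [h] with t ht
    simpa using ht
  have key := deriv_eq_zero_and_nonneg_of_isLocalMin hm
    (h' := fun t => fderiv ℝ φ (t • σ) σ - (2 - p) * t ^ (1 - p) * φ σ)
    (by filter_upwards [h1, hw] with t ht hwt using ht.sub (hwt.mul_const _))
    (h2.sub (hw'.mul_const _))
  simp only [one_smul, Real.one_rpow, map_zero, add_zero] at key
  constructor <;> linarith [key.1, key.2]

end Curves

/-! ### Symmetric forms and the block form of `Φ`. -/

variable {d : ℕ}

theorem Sym.inner_comm (A : Sym d) (v w : E d) :
    inner ℝ ((A : E d →L[ℝ] E d) v) w = inner ℝ ((A : E d →L[ℝ] E d) w) v := by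
  have h := (ContinuousLinearMap.isSelfAdjoint_iff_isSymmetric.1 A.2) v w
  rw [real_inner_comm v]
  exact h

theorem Sym.ext_quadratic {A B : Sym d}
    (h : ∀ w, inner ℝ ((A : E d →L[ℝ] E d) w) w = inner ℝ ((B : E d →L[ℝ] E d) w) w) : A = B := by
  have hs := ContinuousLinearMap.isSelfAdjoint_iff_isSymmetric.1 (A - B).2
  have h0 := (LinearMap.IsSymmetric.inner_map_self_eq_zero hs).1 fun w => by
    simp [inner_sub_left, h w]
  rw [← sub_eq_zero]
  ext1
  ext1 w
  exact congrArg (fun T : E d →ₗ[ℝ] E d => T w) h0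

theorem exists_sym_of_bilin (B : E d →L[ℝ] E d →L[ℝ] ℝ) (hB : ∀ v w, B v w = B w v) :
    ∃ A : Sym d, ∀ v w, inner ℝ ((A : E d →L[ℝ] E d) v) w = B v w := by
  let T : E d →ₗ[ℝ] E d :=
    { toFun := fun v => (InnerProductSpace.toDual ℝ (E d)).symm (B v)
      map_add' := fun v w => by simp
      map_smul' := fun c v => by simp }
  have hT : ∀ v w, inner ℝ (T v) w = B v w := fun v w =>
    InnerProductSpace.toDual_symm_apply
  refine ⟨⟨LinearMap.toContinuousLinearMap T, ?_⟩, hT⟩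
  refine ContinuousLinearMap.isSelfAdjoint_iff_isSymmetric.2 fun v w => ?_
  change inner ℝ (T v) w = inner ℝ v (T w)
  rw [hT, hB, ← hT, real_inner_comm]

theorem snd_fderiv_comm {φ : E d → ℝ} {x : E d} (hφ : ContDiffAt ℝ 2 φ x) (v w : E d) :
    fderiv ℝ (fderiv ℝ φ) x v w = fderiv ℝ (fderiv ℝ φ) x w v :=
  hφ.isSymmSndFDerivAt (by simp) v w

theorem inner_pt_pt (σ : S d) : inner ℝ (σ : E d) (σ : E d) = 1 := by
  rw [real_inner_self_eq_norm_sq, norm_eq_of_mem_sphere]; norm_num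

theorem pt_ne_zero (σ : S d) : (σ : E d) ≠ 0 := by
  intro h
  have := inner_pt_pt σ
  simp [h] at this

/-- The tangential component of a vector at a point of the sphere. -/
noncomputable def tangential (σ : S d) (w : E d) : E d := w - inner ℝ (σ : E d) w • (σ : E d)

theorem inner_tangential (σ : S d) (w : E d) : inner ℝ (σ : E d) (tangential σ w) = 0 := by
  rw [tangential, inner_sub_right, inner_smul_right, inner_pt_pt]; ring

theorem tangential_add (σ : S d) (w : E d) :
    tangential σ w + inner ℝ (σ : E d) w • (σ : E d) = w := by
  simp [tangential]

theorem inner_tangential_left (σ : S d) (w v : E d) (hv : inner ℝ (σ : E d) v = 0) :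
    inner ℝ (tangential σ w) v = inner ℝ w v := by
  rw [tangential, inner_sub_left, real_inner_smul_left, hv]; ring

/-- The quadratic form of `Φ(J)`, in blocks for `ℝⁿ = T_σ S^{n-1} ⊕ ℝσ`. -/
theorem inner_Phi (p : ℝ) (J : SphereJet d) (v : E d) (hv : inner ℝ (J.pt : E d) v = 0) (s : ℝ) :
    inner ℝ ((Phi p J : E d →L[ℝ] E d) (v + s • (J.pt : E d))) (v + s • (J.pt : E d)) =
      inner ℝ ((J.hess : E d →L[ℝ] E d) v) v - (p - 2) * J.val * inner ℝ v v
        - 2 * (p - 1) * s * inner ℝ J.grad v + (p - 2) * (p - 1) * J.val * s ^ 2 := by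
  have h2 : (J.hess : E d →L[ℝ] E d) (J.pt : E d) = 0 := J.2.2
  have h3 := inner_pt_pt J.pt
  have h4 : inner ℝ ((J.hess : E d →L[ℝ] E d) v) (J.pt : E d) = 0 := by
    rw [Sym.inner_comm, h2, inner_zero_left]
  have hv' : inner ℝ v (J.pt : E d) = 0 := by rw [real_inner_comm, hv]
  have h1' : inner ℝ J.grad (J.pt : E d) = 0 := by rw [real_inner_comm]; exact J.2.1
  simp only [Phi, symProd, lineProj, AddSubgroupClass.coe_sub, AddMemClass.coe_add,
    selfAdjoint.val_smul, selfAdjoint.val_one, add_apply,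
    sub_apply, smul_apply, one_apply_eq_self,
    InnerProductSpace.rankOne_apply, map_add, map_smul, inner_add_left, inner_add_right,
    inner_sub_left, real_inner_smul_left, real_inner_smul_right, h2, h3, h4, hv, hv', h1',
    inner_zero_left]
  ring

/-- The 2-jet at `σ` with value `r` whose derivatives are the tangential parts of `q` and `A`. -/
noncomputable def mkJet (σ : S d) (r : ℝ) (q : E d) (A : Sym d) : SphereJet d :=
  ⟨(σ, r, tangential σ q,
    ⟨((1 - lineProj σ : Sym d) : E d →L[ℝ] E d) * (A : E d →L[ℝ] E d) *
      ((1 - lineProj σ : Sym d) : E d →L[ℝ] E d), A.2.conjugate_self (1 - lineProj σ : Sym d).2⟩),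
    inner_tangential σ q, by
      have h : ((1 - lineProj σ : Sym d) : E d →L[ℝ] E d) (σ : E d) = 0 := by
        simp [lineProj]
      show ((1 - lineProj σ : Sym d) : E d →L[ℝ] E d) ((A : E d →L[ℝ] E d)
        (((1 - lineProj σ : Sym d) : E d →L[ℝ] E d) (σ : E d))) = 0
      rw [h, map_zero, map_zero]⟩

theorem inner_mkJet_grad (σ : S d) (r : ℝ) (q : E d) (A : Sym d) (v : E d)
    (hv : inner ℝ (σ : E d) v = 0) : inner ℝ (mkJet σ r q A).grad v = inner ℝ q v :=
  inner_tangential_left σ q v hv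

theorem inner_mkJet_hess (σ : S d) (r : ℝ) (q : E d) (A : Sym d) (v : E d)
    (hv : inner ℝ (σ : E d) v = 0) :
    inner ℝ (((mkJet σ r q A).hess : E d →L[ℝ] E d) v) v =
      inner ℝ ((A : E d →L[ℝ] E d) v) v := by
  have h : ((1 - lineProj σ : Sym d) : E d →L[ℝ] E d) v = v := by simp [lineProj, hv]
  show inner ℝ (((1 - lineProj σ : Sym d) : E d →L[ℝ] E d) ((A : E d →L[ℝ] E d)
    (((1 - lineProj σ : Sym d) : E d →L[ℝ] E d) v))) v = _
  rw [Sym.inner_comm, h, real_inner_comm]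

/-- Only the mixed and radial entries of `A` are constrained by the value and gradient. The
tangential block is free, and the shift by `(p-2) r` cancels the term `-(p-2) r P_{σ^⊥}` of `Φ`. -/
theorem Phi_mkJet (p : ℝ) (σ : S d) (r : ℝ) (q : E d) (A : Sym d)
    (hq : ∀ v, inner ℝ (σ : E d) v = 0 →
      inner ℝ ((A : E d →L[ℝ] E d) (σ : E d)) v = -((p - 1) * inner ℝ q v))
    (hr : inner ℝ ((A : E d →L[ℝ] E d) (σ : E d)) (σ : E d) = (p - 2) * (p - 1) * r) :
    Phi p (mkJet σ r q (A + ((p - 2) * r) • 1)) = A := by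
  refine Sym.ext_quadratic fun w => ?_
  obtain ⟨v, s, hv, rfl⟩ : ∃ v s, inner ℝ (σ : E d) v = 0 ∧ w = v + s • (σ : E d) :=
    ⟨_, _, inner_tangential σ w, (tangential_add σ w).symm⟩
  refine (inner_Phi p (mkJet σ r q (A + ((p - 2) * r) • 1)) v hv s).trans ?_
  rw [inner_mkJet_grad σ _ _ _ v hv, inner_mkJet_hess σ _ _ _ v hv]
  change _ - (p - 2) * r * inner ℝ v v - _ + (p - 2) * (p - 1) * r * s ^ 2 = _
  simp only [map_add, map_smul, inner_add_left, inner_add_right, real_inner_smul_left,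
    real_inner_smul_right, hr, hq v hv, Sym.inner_comm A v (σ : E d), AddMemClass.coe_add,
    selfAdjoint.val_smul, selfAdjoint.val_one, add_apply, smul_apply, one_apply_eq_self]
  ring

theorem continuous_mkJet (σ : S d) {X : Type*} [TopologicalSpace X] {r : X → ℝ} {q : X → E d}
    {A : X → Sym d} (hr : Continuous r) (hq : Continuous q) (hA : Continuous A) :
    Continuous fun x => mkJet σ (r x) (q x) (A x) := by
  refine Continuous.subtype_mk ?_ _
  refine continuous_const.prodMk (hr.prodMk (Continuous.prodMk ?_ (Continuous.subtype_mk ?_ _)))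
  · unfold tangential
    fun_prop
  · fun_prop

/-! ### Continuity and fibrewise inversion of `Φ`. -/

theorem coe_Phi (p : ℝ) (J : SphereJet d) : (Phi p J : E d →L[ℝ] E d) =
    (J.hess : E d →L[ℝ] E d)
      - ((p - 2) * J.val) • (1 - InnerProductSpace.rankOne ℝ (J.pt : E d) (J.pt : E d))
      - (p - 1) • (InnerProductSpace.rankOne ℝ (J.pt : E d) J.grad +
        InnerProductSpace.rankOne ℝ J.grad (J.pt : E d))
      + ((p - 2) * (p - 1) * J.val) • InnerProductSpace.rankOne ℝ (J.pt : E d) (J.pt : E d) :=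
  rfl

theorem continuous_Phi (p : ℝ) : Continuous (Phi p : SphereJet d → Sym d) := by
  have hpt : Continuous fun J : SphereJet d => (J.pt : E d) :=
    continuous_subtype_val.comp (continuous_fst.comp continuous_subtype_val)
  have hval : Continuous fun J : SphereJet d => J.val :=
    continuous_fst.comp (continuous_snd.comp continuous_subtype_val)
  have hgrad : Continuous fun J : SphereJet d => J.grad :=
    continuous_fst.comp (continuous_snd.comp (continuous_snd.comp continuous_subtype_val))
  have hhess : Continuous fun J : SphereJet d => (J.hess : E d →L[ℝ] E d) :=
    continuous_subtype_val.comp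
      (continuous_snd.comp (continuous_snd.comp (continuous_snd.comp continuous_subtype_val)))
  have hrank : ∀ a b : SphereJet d → E d, Continuous a → Continuous b →
      Continuous fun J => InnerProductSpace.rankOne ℝ (a J) (b J) := fun a b ha hb =>
    ((InnerProductSpace.rankOne ℝ).continuous.comp ha).clm_apply hb
  have h₁ := hrank _ _ hpt hpt
  have h₂ := hrank _ _ hpt hgrad
  have h₃ := hrank _ _ hgrad hpt
  refine continuous_induced_rng.2 ?_
  simp only [Function.comp_def, coe_Phi]
  fun_prop

theorem Phi_neg (p : ℝ) (J : SphereJet d) : Phi p J.neg = -Phi p J := by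
  refine Subtype.ext (ContinuousLinearMap.ext fun w => ?_)
  change -(J.hess : E d →L[ℝ] E d) w
      - ((p - 2) * -J.val) • (w - inner ℝ (J.pt : E d) w • (J.pt : E d))
      - (p - 1) • (inner ℝ (-J.grad) w • (J.pt : E d) + inner ℝ (J.pt : E d) w • -J.grad)
      + ((p - 2) * (p - 1) * -J.val) • inner ℝ (J.pt : E d) w • (J.pt : E d) =
    -((J.hess : E d →L[ℝ] E d) w
      - ((p - 2) * J.val) • (w - inner ℝ (J.pt : E d) w • (J.pt : E d))
      - (p - 1) • (inner ℝ J.grad w • (J.pt : E d) + inner ℝ (J.pt : E d) w • J.grad)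
      + ((p - 2) * (p - 1) * J.val) • inner ℝ (J.pt : E d) w • (J.pt : E d))
  rw [inner_neg_left]
  module

theorem Phi_apply_pt (p : ℝ) (J : SphereJet d) :
    (Phi p J : E d →L[ℝ] E d) (J.pt : E d) =
      ((p - 2) * (p - 1) * J.val) • (J.pt : E d) - (p - 1) • J.grad := by
  have h2 : (J.hess : E d →L[ℝ] E d) (J.pt : E d) = 0 := J.2.2
  have h3 := inner_pt_pt J.pt
  have h1 : inner ℝ J.grad (J.pt : E d) = 0 := by rw [real_inner_comm]; exact J.2.1
  simp only [Phi, symProd, lineProj, AddSubgroupClass.coe_sub, AddMemClass.coe_add,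
    selfAdjoint.val_smul, selfAdjoint.val_one, add_apply, sub_apply, smul_apply,
    one_apply_eq_self, InnerProductSpace.rankOne_apply, h1, h2, h3]
  module

/-- A right inverse of `Φ` with values in the fibre over `σ`, when `p ≠ 1, 2`. -/
noncomputable def PhiSection (p : ℝ) (σ : S d) (A : Sym d) : SphereJet d :=
  mkJet σ (((p - 2) * (p - 1))⁻¹ * inner ℝ ((A : E d →L[ℝ] E d) (σ : E d)) (σ : E d))
    (-((p - 1)⁻¹ • (A : E d →L[ℝ] E d) (σ : E d)))
    (A + ((p - 2) *
      (((p - 2) * (p - 1))⁻¹ * inner ℝ ((A : E d →L[ℝ] E d) (σ : E d)) (σ : E d))) • 1)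

theorem continuous_PhiSection (p : ℝ) (σ : S d) : Continuous (PhiSection p σ) := by
  have h : Continuous fun A : Sym d => (A : E d →L[ℝ] E d) (σ : E d) :=
    (ContinuousLinearMap.apply ℝ (E d) (σ : E d)).continuous.comp continuous_subtype_val
  have hr := h.inner (𝕜 := ℝ) (continuous_const (y := (σ : E d)))
  have hA : Continuous fun A : Sym d => (A + ((p - 2) * (((p - 2) * (p - 1))⁻¹ *
      inner ℝ ((A : E d →L[ℝ] E d) (σ : E d)) (σ : E d))) • 1 : Sym d) := by
    refine continuous_induced_rng.2 ?_
    simp only [Function.comp_def, AddMemClass.coe_add, selfAdjoint.val_smul, selfAdjoint.val_one]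
    fun_prop
  exact continuous_mkJet σ (by fun_prop) (by fun_prop) hA

theorem Phi_PhiSection {p : ℝ} (hp1 : p ≠ 1) (hp2 : p ≠ 2) (σ : S d) (A : Sym d) :
    Phi p (PhiSection p σ A) = A := by
  have h1 : p - 1 ≠ 0 := sub_ne_zero.2 hp1
  have h2 : p - 2 ≠ 0 := sub_ne_zero.2 hp2
  apply Phi_mkJet
  · intro v _
    rw [inner_neg_left, real_inner_smul_left]
    field_simp
  · field_simp

/-- By `Phi_apply_pt`, the image of the base point under `Φ(J)` has the value as radial part and the
gradient as tangential part, up to nonzero factors. The Hessian is then what remains. -/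
theorem eq_of_Phi_eq {p : ℝ} (hp1 : p ≠ 1) (hp2 : p ≠ 2) {J K : SphereJet d}
    (hpt : J.pt = K.pt) (h : Phi p J = Phi p K) : J = K := by
  have h1 : p - 1 ≠ 0 := sub_ne_zero.2 hp1
  have h2 : p - 2 ≠ 0 := sub_ne_zero.2 hp2
  have hJ := Phi_apply_pt p J
  rw [h, hpt, Phi_apply_pt p K] at hJ
  have oJ : inner ℝ (K.pt : E d) J.grad = 0 := by rw [← hpt]; exact J.2.1
  have oK : inner ℝ (K.pt : E d) K.grad = 0 := K.2.1
  have hval : J.val = K.val := by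
    have := congrArg (fun z => inner ℝ (K.pt : E d) z) hJ
    simp only [inner_sub_right, real_inner_smul_right, oJ, oK, inner_pt_pt, mul_zero, mul_one,
      sub_zero] at this
    exact (mul_left_cancel₀ (mul_ne_zero h2 h1) this).symm
  have hgrad : J.grad = K.grad := by
    rw [hval, sub_right_inj] at hJ
    exact (smul_right_injective _ h1 hJ).symm
  have hhess : J.hess = K.hess := by
    simpa [Phi, hpt, hval, hgrad] using h
  exact Subtype.ext (Prod.ext hpt (Prod.ext hval (Prod.ext hgrad hhess)))

/-! ### Duality. -/

theorem jetDual_onSphere_subset (p : ℝ) (F : Set (Sym d)) :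
    jetDual (onSphere p F) ⊆ onSphere p (dual F) := by
  intro J hJ hi
  rw [← Phi_neg] at hi
  exact hJ (preimage_interior_subset_interior_preimage (continuous_Phi p) hi)

theorem jetDual_onSphere {p : ℝ} (hp1 : p ≠ 1) (hp2 : p ≠ 2) (F : Set (Sym d)) :
    jetDual (onSphere p F) = onSphere p (dual F) := by
  refine (jetDual_onSphere_subset p F).antisymm fun J hJ hi => hJ ?_
  rw [← Phi_neg]
  -- The section passes through the given jet, so a neighbourhood of that jet in the whole bundle
  -- pulls back along it to a neighbourhood of `Φ` of the jet.
  have hs : PhiSection p J.neg.pt (Phi p J.neg) = J.neg :=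
    eq_of_Phi_eq hp1 hp2 rfl (Phi_PhiSection hp1 hp2 _ _)
  rw [mem_interior_iff_mem_nhds] at hi ⊢
  rw [← hs] at hi
  filter_upwards [(continuous_PhiSection p J.neg.pt).continuousAt.preimage_mem_nhds hi] with A hA
  have hA' : Phi p (PhiSection p J.neg.pt A) ∈ F := hA
  rwa [Phi_PhiSection hp1 hp2] at hA'

/-- The interior of `F` inherits positivity and the cone property, since translations and dilations
are homeomorphisms; both pass to the complement after the change of sign. -/
theorem IsConeSubequation.dual {F : Set (Sym d)} (hF : IsConeSubequation F) :
    IsConeSubequation (dual F) where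
  isClosed := isOpen_compl_iff.1 <| by
    have : (HomogeneousSubharmonics.dual F)ᶜ = (fun A => -A) ⁻¹' interior F := by
      ext A; simp [HomogeneousSubharmonics.dual]
    rw [this]
    exact isOpen_interior.preimage continuous_neg
  positivity A hA P hP hi := hA <| by
    rw [mem_interior_iff_mem_nhds] at hi ⊢
    have hc : Continuous fun B : Sym d => B - P := by fun_prop
    have := hc.continuousAt.preimage_mem_nhds (x := -A) (by rwa [show -A - P = -(A + P) by abel])
    filter_upwards [this] with B hB
    simpa using hF.positivity _ hB P hP
  cone A hA t ht hi := hA <| by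
    rw [mem_interior_iff_mem_nhds] at hi ⊢
    have hc : Continuous fun B : Sym d => t • B  := by
      refine continuous_induced_rng.2 ?_
      simp only [Function.comp_def, selfAdjoint.val_smul]
      fun_prop
    have := hc.continuousAt.preimage_mem_nhds (x := -A)
      (by rwa [show t • -A = -(t • A) from smul_neg t A])
    filter_upwards [this] with B hB
    have h := hF.cone _ hB t⁻¹ (inv_pos.2 ht)
    rwa [inv_smul_smul₀ ht.ne'] at h

/-! ### The radial projection. -/

open Classical in
/-- The radial projection, with an arbitrary value at the origin. -/
noncomputable def radial (σ : S d) (x : E d) : S d :=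
  if hx : x ≠ 0 then radialProj x hx else σ

theorem radial_of_ne (σ : S d) {x : E d} (hx : x ≠ 0) : radial σ x = radialProj x hx :=
  dif_pos hx

theorem coe_radial (σ : S d) {x : E d} (hx : x ≠ 0) : (radial σ x : E d) = ‖x‖⁻¹ • x := by
  rw [radial_of_ne σ hx]; rfl

theorem radial_smul (σ τ : S d) {t : ℝ} (ht : 0 < t) : radial σ (t • (τ : E d)) = τ := by
  ext1
  rw [coe_radial σ (smul_ne_zero ht.ne' (pt_ne_zero τ)), norm_smul, norm_eq_of_mem_sphere,
    smul_smul, Real.norm_of_nonneg ht.le, mul_one, inv_mul_cancel₀ ht.ne', one_smul]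

theorem radial_coe (σ τ : S d) : radial σ (τ : E d) = τ := by
  simpa using radial_smul σ τ one_pos

theorem contMDiffAt_radial (σ : S d) {x : E d} (hx : x ≠ 0) :
    ContMDiffAt 𝓘(ℝ, E d) (𝓡 d) 2 (radial σ) x := by
  -- Restricting the codomain to the sphere needs a map smooth on a whole manifold, hence the
  -- passage to the punctured space.
  let U : TopologicalSpace.Opens (E d) := ⟨{0}ᶜ, isOpen_compl_singleton⟩
  have hf : ContMDiff 𝓘(ℝ, E d) 𝓘(ℝ, E d) 2 (fun y : U => ‖(y : E d)‖⁻¹ • (y : E d)) := by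
    intro y
    have hy : (y : E d) ≠ 0 := y.2
    have h : ContDiffAt ℝ 2 (fun z : E d => ‖z‖⁻¹ • z) (y : E d) :=
      ((contDiffAt_norm ℝ hy).inv (norm_ne_zero_iff.2 hy)).smul contDiffAt_id
    exact contMDiffAt_subtype_iff.2 h.contMDiffAt
  have hm : ∀ y : U, ‖(y : E d)‖⁻¹ • (y : E d) ∈ Metric.sphere (0 : E d) 1 := fun y =>
    (radialProj (y : E d) y.2).2
  have := Fact.mk (@finrank_euclideanSpace_fin ℝ _ (d + 1))
  have h := hf.codRestrict_sphere (n := d) hm ⟨x, hx⟩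
  refine (contMDiffAt_subtype_iff (U := U) (x := ⟨x, hx⟩)).1 (h.congr_of_eventuallyEq ?_)
  exact Filter.Eventually.of_forall fun y => radial_of_ne σ y.2

theorem continuousAt_radial (σ : S d) {x : E d} (hx : x ≠ 0) : ContinuousAt (radial σ) x :=
  (contMDiffAt_radial σ hx).continuousAt

/-! ### Derivatives along geodesics and of homogeneous functions. -/

/-- First and second derivatives, at the pole `σ`, of `f^(p-2) φ(f γ)` where `γ` is a geodesic
of the sphere and `f = 1 + α sin`. -/
theorem derivs_along_geodesic {p α r : ℝ} {φ : E d → ℝ} {σ v : E d} (hφ : ContDiffAt ℝ 2 φ σ)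
    (hr : φ σ = r) (h1 : fderiv ℝ φ σ σ = (2 - p) * r) :
    deriv (fun t => (1 + α * Real.sin t) ^ (p - 2) *
        φ ((1 + α * Real.sin t) • (Real.cos t • σ + Real.sin t • v))) 0 = fderiv ℝ φ σ v ∧
      iteratedDeriv 2 (fun t => (1 + α * Real.sin t) ^ (p - 2) *
        φ ((1 + α * Real.sin t) • (Real.cos t • σ + Real.sin t • v))) 0 =
        fderiv ℝ (fderiv ℝ φ) σ v v + (p - 2) * r +
          2 * α * (fderiv ℝ (fderiv ℝ φ) σ σ v + (p - 1) * fderiv ℝ φ σ v) +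
          α ^ 2 * (fderiv ℝ (fderiv ℝ φ) σ σ σ - (p - 2) * (p - 1) * r) := by
  have hf : ∀ t, HasDerivAt (fun t => 1 + α * Real.sin t) (α * Real.cos t) t := fun t =>
    ((Real.hasDerivAt_sin t).const_mul α).const_add 1
  have hf' : ∀ t, HasDerivAt (fun t => α * Real.cos t) (α * -Real.sin t) t := fun t =>
    (Real.hasDerivAt_cos t).const_mul α
  have hγ : ∀ t, HasDerivAt (fun t => Real.cos t • σ + Real.sin t • v)
      (-Real.sin t • σ + Real.cos t • v) t := fun t =>
    ((Real.hasDerivAt_cos t).smul_const σ).add ((Real.hasDerivAt_sin t).smul_const v)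
  have hγ' : ∀ t, HasDerivAt (fun t => -Real.sin t • σ + Real.cos t • v)
      (-Real.cos t • σ + -Real.sin t • v) t := fun t =>
    ((Real.hasDerivAt_sin t).neg.smul_const σ).add ((Real.hasDerivAt_cos t).smul_const v)
  have hpos : ∀ᶠ t in 𝓝 (0 : ℝ), 1 + α * Real.sin t ≠ 0 :=
    (hf 0).continuousAt.eventually_ne (by simp)
  have hw : ∀ᶠ t in 𝓝 (0 : ℝ), HasDerivAt (fun t => (1 + α * Real.sin t) ^ (p - 2))
      (α * Real.cos t * (p - 2) * (1 + α * Real.sin t) ^ (p - 2 - 1)) t :=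
    hpos.mono fun t ht => (hf t).rpow_const (Or.inl ht)
  have hw' := ((hf' 0).mul_const (p - 2)).mul
    ((hf 0).rpow_const (p := p - 2 - 1) (Or.inl (by simp)))
  have hσ : (1 + α * Real.sin 0) • (Real.cos 0 • σ + Real.sin 0 • v) = σ := by simp
  have key := derivs_mul_comp_curve (a := 0) (φ := φ)
    (x := fun t => (1 + α * Real.sin t) • (Real.cos t • σ + Real.sin t • v))
    (by rw [hσ]; exact hφ) (fun t => (hf t).smul (hγ t))
    (((hf 0).smul (hγ' 0)).add ((hf' 0).smul (hγ 0))) hw hw'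
  have hs : fderiv ℝ (fderiv ℝ φ) σ v σ = fderiv ℝ (fderiv ℝ φ) σ σ v := snd_fderiv_comm hφ v σ
  refine ⟨key.1.trans ?_, key.2.trans ?_⟩
  · simp [h1, hr]
    ring
  · simp [h1, hr, hs]
    ring

/-- The first derivative of a positively homogeneous function of degree `2 - p` is homogeneous of
degree `1 - p`. -/
theorem snd_fderiv_of_homogeneous {p : ℝ} {φ : E d → ℝ} {σ : E d} (hσ : σ ≠ 0)
    (hφ : ContDiffAt ℝ 2 φ σ)
    (hom : ∀ t : ℝ, 0 < t → ∀ x ≠ 0, φ (t • x) = t ^ (2 - p) * φ x) (v : E d) :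
    fderiv ℝ (fderiv ℝ φ) σ σ v = (1 - p) * fderiv ℝ φ σ v := by
  have h1 : ∀ t : ℝ, 0 < t → fderiv ℝ φ (t • σ) v = t ^ (1 - p) * fderiv ℝ φ σ v := by
    intro t ht
    have he : (fun x => φ (t • x)) =ᶠ[𝓝 σ] fun x => t ^ (2 - p) * φ x := by
      filter_upwards [isOpen_ne.mem_nhds hσ] with x hx using hom t ht x hx
    have hd := he.fderiv_eq (𝕜 := ℝ)
    rw [fderiv_comp_smul, fderiv_const_mul (hφ.differentiableAt (by simp))] at hd
    have hv := congrArg (fun L : E d →L[ℝ] ℝ => L v) hd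
    simp only [smul_apply, smul_eq_mul] at hv
    rw [show 2 - p = (1 - p) + 1 by ring, Real.rpow_add_one ht.ne'] at hv
    exact mul_left_cancel₀ ht.ne' (by rw [hv]; ring)
  have h2 : ContDiffAt ℝ 1 (fderiv ℝ φ) σ := hφ.fderiv_right (by norm_num)
  have hx : HasDerivAt (fun t : ℝ => t • σ) σ 1 := by
    simpa using (hasDerivAt_id (1 : ℝ)).smul_const σ
  have hL : HasDerivAt (fun t : ℝ => fderiv ℝ φ (t • σ) v) (fderiv ℝ (fderiv ℝ φ) σ σ v) 1 := by
    have h := HasFDerivAt.comp_hasDerivAt (l := fderiv ℝ φ) (l' := fderiv ℝ (fderiv ℝ φ) σ)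
      (1 : ℝ) (by rw [one_smul]; exact (h2.differentiableAt (by simp)).hasFDerivAt) hx
    simpa using h.clm_apply (hasDerivAt_const (1 : ℝ) v)
  have hR : HasDerivAt (fun t : ℝ => t ^ (1 - p) * fderiv ℝ φ σ v)
      ((1 - p) * fderiv ℝ φ σ v) 1 := by
    simpa using (Real.hasDerivAt_rpow_const (x := 1) (p := 1 - p) (Or.inl one_ne_zero)).mul_const
      (fderiv ℝ φ σ v)
  refine hL.unique (hR.congr_of_eventuallyEq ?_)
  filter_upwards [lt_mem_nhds (one_pos (α := ℝ))] with t ht using h1 t ht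

/-- The second derivative of the homogeneous extension of `ψ` is `Φ` of the 2-jet of `ψ`. -/
theorem exists_isTwoJetAt {p : ℝ} {φ : E d → ℝ} {ψ : S d → ℝ} {σ : S d}
    (hφ : ContDiffAt ℝ 2 φ (σ : E d)) (hψ : ∀ τ : S d, φ τ = ψ τ)
    (hom : ∀ t : ℝ, 0 < t → ∀ x ≠ 0, φ (t • x) = t ^ (2 - p) * φ x) {A : Sym d}
    (hA : ∀ v w, inner ℝ ((A : E d →L[ℝ] E d) v) w = fderiv ℝ (fderiv ℝ φ) (σ : E d) v w) :
    ∃ J : SphereJet d, Phi p J = A ∧ IsTwoJetAt ψ σ J := by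
  have hD := snd_fderiv_of_homogeneous (pt_ne_zero σ) hφ hom
  have hrad : fderiv ℝ φ (σ : E d) σ = (2 - p) * ψ σ := by
    rw [← hψ]
    refine (radial_derivs_of_le hφ ?_).1
    filter_upwards [lt_mem_nhds (one_pos (α := ℝ))] with t ht
      using (hom t ht _ (pt_ne_zero σ)).ge
  let q : E d := (InnerProductSpace.toDual ℝ (E d)).symm (fderiv ℝ φ (σ : E d))
  have hq : ∀ v, inner ℝ q v = fderiv ℝ φ (σ : E d) v := fun v =>
    InnerProductSpace.toDual_symm_apply
  refine ⟨mkJet σ (ψ σ) q (A + ((p - 2) * ψ σ) • 1), Phi_mkJet p σ (ψ σ) q A ?_ ?_, rfl, rfl, ?_⟩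
  · intro v _
    rw [hA, hD, hq]
    ring
  · rw [hA, hD, hrad]
    ring
  · intro v hv hσv
    have hγ : ∀ t, (1 + 0 * Real.sin t) ^ (p - 2) *
        φ ((1 + 0 * Real.sin t) • (Real.cos t • (σ : E d) + Real.sin t • v)) =
        ψ (geodesic σ v hv hσv t) := fun t => by
      rw [← hψ]
      simp [geodesic]
    -- With `α = 0` the curve is the geodesic itself. Its acceleration `-σ` contributes `-Dφ(σ) =
    -- (p-2) ψ(σ)`, the shift built into the jet.
    have key := derivs_along_geodesic (p := p) (α := 0) (v := v) hφ (hψ σ) hrad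
    simp only [hγ] at key
    rw [key.1, key.2, inner_mkJet_grad σ _ _ _ v hσv, inner_mkJet_hess σ _ _ _ v hσv]
    refine ⟨hq v, ?_⟩
    simp only [AddMemClass.coe_add, selfAdjoint.val_smul, selfAdjoint.val_one, add_apply,
      smul_apply, one_apply_eq_self, inner_add_left, real_inner_smul_left, hA,
      real_inner_self_eq_norm_sq, hv]
    ring

/-! ### Test functions for `u` at points of the sphere. -/

theorem eq_of_homogeneous {p : ℝ} {u : E d → EReal} {g : S d → EReal}
    (hom : ∀ t : ℝ, 0 < t → ∀ τ : S d, u (t • (τ : E d)) = ((t ^ (2 - p) : ℝ) : EReal) * g τ)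
    (τ : S d) : u τ = g τ := by
  simpa using hom 1 one_pos τ

theorem radial_le_of_touching {p : ℝ} {u : E d → EReal} {g : S d → EReal}
    (hom : ∀ t : ℝ, 0 < t → ∀ τ : S d, u (t • (τ : E d)) = ((t ^ (2 - p) : ℝ) : EReal) * g τ)
    {σ : S d} {φ : E d → ℝ} (hle : ∀ᶠ y in 𝓝 (σ : E d), u y ≤ (φ y : EReal))
    (heq : u σ = (φ σ : EReal)) :
    ∀ᶠ t : ℝ in 𝓝 1, t ^ (2 - p) * φ σ ≤ φ (t • (σ : E d)) := by
  have hc : Filter.Tendsto (fun t : ℝ => t • (σ : E d)) (𝓝 1) (𝓝 (σ : E d)) := by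
    have : Continuous fun t : ℝ => t • (σ : E d) := by fun_prop
    simpa using this.tendsto 1
  filter_upwards [lt_mem_nhds (one_pos (α := ℝ)), hc.eventually hle] with t ht h
  rw [hom t ht, ← eq_of_homogeneous hom, heq, ← EReal.coe_mul, EReal.coe_le_coe_iff] at h
  exact h

/-- If `φ` touches `u` from above at `σ`, then for `f = 1 + ⟨a, ·⟩` the function
`τ ↦ f(τ)^(p-2) φ(f(τ) τ)` touches `g` from above at `σ`. -/
theorem eventually_le_of_touching {p : ℝ} {u : E d → EReal} {g : S d → EReal}
    (hom : ∀ t : ℝ, 0 < t → ∀ τ : S d, u (t • (τ : E d)) = ((t ^ (2 - p) : ℝ) : EReal) * g τ)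
    {σ : S d} {φ : E d → ℝ} (hle : ∀ᶠ y in 𝓝 (σ : E d), u y ≤ (φ y : EReal)) {a : E d}
    (ha : inner ℝ a (σ : E d) = 0) :
    ∀ᶠ τ : S d in 𝓝 σ, g τ ≤ (((1 + inner ℝ a (τ : E d)) ^ (p - 2) *
      φ ((1 + inner ℝ a (τ : E d)) • (τ : E d)) : ℝ) : EReal) := by
  have hf : Continuous fun τ : S d => 1 + inner ℝ a (τ : E d) := by fun_prop
  have hc : Filter.Tendsto (fun τ : S d => (1 + inner ℝ a (τ : E d)) • (τ : E d)) (𝓝 σ)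
      (𝓝 (σ : E d)) := by
    have : Continuous fun τ : S d => (1 + inner ℝ a (τ : E d)) • (τ : E d) := by fun_prop
    simpa [ha] using this.tendsto σ
  have hpos : ∀ᶠ τ : S d in 𝓝 σ, 0 < 1 + inner ℝ a (τ : E d) :=
    hf.continuousAt.eventually (lt_mem_nhds (by simp [ha]))
  filter_upwards [hpos, hc.eventually hle] with τ ht h
  set f := 1 + inner ℝ a (τ : E d)
  have h1 : ((f ^ (p - 2) : ℝ) : EReal) * ((f ^ (2 - p) : ℝ) : EReal) = 1 := by
    rw [← EReal.coe_mul, ← Real.rpow_add ht]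
    simp
  rw [hom f ht] at h
  calc g τ = ((f ^ (p - 2) : ℝ) : EReal) * (((f ^ (2 - p) : ℝ) : EReal) * g τ) := by
        rw [← mul_assoc, h1, one_mul]
    _ ≤ ((f ^ (p - 2) : ℝ) : EReal) * (φ (f • (τ : E d)) : EReal) :=
        mul_le_mul_of_nonneg_left h (EReal.coe_nonneg.2 (Real.rpow_nonneg ht.le _))
    _ = _ := (EReal.coe_mul _ _).symm

theorem contMDiffAt_scaled_restriction {p : ℝ} {σ : S d} {φ : E d → ℝ}
    (hφ : ContDiffAt ℝ 2 φ (σ : E d)) {a : E d} (ha : inner ℝ a (σ : E d) = 0) :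
    ContMDiffAt (𝓡 d) 𝓘(ℝ, ℝ) 2 (fun τ : S d => (1 + inner ℝ a (τ : E d)) ^ (p - 2) *
      φ ((1 + inner ℝ a (τ : E d)) • (τ : E d))) σ := by
  have := Fact.mk (@finrank_euclideanSpace_fin ℝ _ (d + 1))
  have hf : ContDiff ℝ 2 fun x : E d => 1 + inner ℝ a x :=
    contDiff_const.add (contDiff_const.inner ℝ contDiff_id)
  have h : ContDiffAt ℝ 2 (fun x : E d => (1 + inner ℝ a x) ^ (p - 2) *
      φ ((1 + inner ℝ a x) • x)) (σ : E d) := by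
    refine (hf.contDiffAt.rpow_const_of_ne (by simp [ha])).mul ?_
    refine ContDiffAt.comp (g := φ) (f := fun x : E d => (1 + inner ℝ a x) • x) (σ : E d) ?_
      (hf.contDiffAt.smul contDiffAt_id)
    simpa [ha] using hφ
  exact h.contMDiffAt.comp σ (contMDiff_coe_sphere (n := d) (m := 2)).contMDiffAt

/-- The forms `⟨q, ·⟩` and `⟨H ·, ·⟩` of a 2-jet, for arbitrary tangent vectors, are determined by
their values at unit vectors. -/
theorem jet_forms_of_unit {σ q : E d} {H : Sym d} {ℓ : E d →L[ℝ] ℝ} {Q : Sym d}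
    (h : ∀ v, ‖v‖ = 1 → inner ℝ σ v = 0 → inner ℝ q v = ℓ v ∧
      inner ℝ ((H : E d →L[ℝ] E d) v) v = inner ℝ ((Q : E d →L[ℝ] E d) v) v)
    (v : E d) (hv : inner ℝ σ v = 0) : inner ℝ q v = ℓ v ∧
      inner ℝ ((H : E d →L[ℝ] E d) v) v = inner ℝ ((Q : E d →L[ℝ] E d) v) v := by
  rcases eq_or_ne v 0 with rfl | h0
  · simp
  have hn : ‖v‖ ≠ 0 := norm_ne_zero_iff.2 h0
  obtain ⟨w, hw, hvw⟩ : ∃ w : E d, ‖w‖ = 1 ∧ v = ‖v‖ • w :=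
    ⟨‖v‖⁻¹ • v, by rw [norm_smul, norm_inv, norm_norm, inv_mul_cancel₀ hn],
      by rw [smul_smul, mul_inv_cancel₀ hn, one_smul]⟩
  have hσw : inner ℝ σ w = 0 := by
    rw [hvw, real_inner_smul_right] at hv
    exact (mul_eq_zero.1 hv).resolve_left hn
  obtain ⟨h1, h2⟩ := h w hw hσw
  rw [hvw]
  simp only [map_smul, real_inner_smul_left, real_inner_smul_right, smul_eq_mul, h1, h2, and_self]

/-- The strict radial inequality lets the mixed entries of `A` be absorbed by tilting the
hypersurface on which `φ` is restricted. -/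
theorem mem_of_touching_of_lt {p : ℝ} {F : Set (Sym d)} (hF : IsConeSubequation F)
    {u : E d → EReal} {g : S d → EReal}
    (hom : ∀ t : ℝ, 0 < t → ∀ τ : S d, u (t • (τ : E d)) = ((t ^ (2 - p) : ℝ) : EReal) * g τ)
    (hg : IsSphereSubharmonic (onSphere p F) g) {σ : S d} {φ : E d → ℝ}
    (hφ : ContDiffAt ℝ 2 φ (σ : E d)) (hle : ∀ᶠ y in 𝓝 (σ : E d), u y ≤ (φ y : EReal))
    (heq : u σ = (φ σ : EReal))
    (hc : (p - 2) * (p - 1) * φ σ < fderiv ℝ (fderiv ℝ φ) (σ : E d) σ σ) {A : Sym d}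
    (hA : ∀ v w, inner ℝ ((A : E d →L[ℝ] E d) v) w = fderiv ℝ (fderiv ℝ φ) (σ : E d) v w) :
    A ∈ F := by
  obtain ⟨hr, -⟩ := radial_derivs_of_le hφ (radial_le_of_touching hom hle heq)
  set r := φ σ with hr_def
  set c := fderiv ℝ (fderiv ℝ φ) (σ : E d) σ σ - (p - 2) * (p - 1) * r with hc_def
  have hc0 : 0 < c := sub_pos.2 hc
  let q : E d := (InnerProductSpace.toDual ℝ (E d)).symm (fderiv ℝ φ (σ : E d))
  have hq : ∀ v, inner ℝ q v = fderiv ℝ φ (σ : E d) v := fun v =>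
    InnerProductSpace.toDual_symm_apply
  -- Tangentially, `b` is the defect in Euler's relation `D²φ(σ,v) = (1-p) Dφ(v)`.
  let b : E d := (A : E d →L[ℝ] E d) (σ : E d) + (p - 1) • q
  have hb : ∀ v, inner ℝ b v = fderiv ℝ (fderiv ℝ φ) (σ : E d) σ v +
      (p - 1) * fderiv ℝ φ (σ : E d) v := fun v => by
    rw [inner_add_left, hA, real_inner_smul_left, hq]
  -- For a unit tangent `v` and `α = ⟨a,v⟩`, the Hessian of the restriction contains `2α⟨b,v⟩ +
  -- cα²`. This `a` minimizes it in all directions at once, with minimum `-c⁻¹⟨b,v⟩²`.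
  let a : E d := (-c⁻¹) • tangential σ b
  have haσ : inner ℝ a (σ : E d) = 0 := by
    rw [real_inner_smul_left, real_inner_comm, inner_tangential, mul_zero]
  have ha : ∀ v, inner ℝ (σ : E d) v = 0 → inner ℝ a v = -c⁻¹ * inner ℝ b v := fun v hv => by
    rw [real_inner_smul_left, inner_tangential_left σ b v hv]
  obtain ⟨J, hJF, hpt, hval, hJ⟩ := hg.2.2 σ _ (contMDiffAt_scaled_restriction (p := p) hφ haσ)
    (eventually_le_of_touching hom hle haσ)
    (by rw [← eq_of_homogeneous hom, heq]; simp [haσ, hr_def])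
  replace hval : J.val = r := by simpa [haσ] using hval
  have hunit : ∀ v, ‖v‖ = 1 → inner ℝ (σ : E d) v = 0 →
      inner ℝ J.grad v = fderiv ℝ φ (σ : E d) v ∧
      inner ℝ ((J.hess : E d →L[ℝ] E d) v) v =
        inner ℝ (((A + ((p - 2) * r) • 1 - (c⁻¹ * 2⁻¹) • symProd b b : Sym d) :
          E d →L[ℝ] E d) v) v := by
    intro v hv hσv
    have hf : ∀ t, inner ℝ a (geodesic σ v hv hσv t : E d) = inner ℝ a v * Real.sin t :=
      fun t => by
        change inner ℝ a (Real.cos t • (σ : E d) + Real.sin t • v) = _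
        rw [inner_add_right, real_inner_smul_right, real_inner_smul_right, haσ]
        ring
    have key := derivs_along_geodesic (p := p) (α := inner ℝ a v) (v := v) hφ rfl hr
    obtain ⟨h1, h2⟩ := hJ v hv hσv
    simp only [hf] at h1 h2
    refine ⟨h1.trans key.1, (h2.trans key.2).trans ?_⟩
    simp only [AddSubgroupClass.coe_sub, AddMemClass.coe_add, selfAdjoint.val_smul,
      selfAdjoint.val_one, symProd, add_apply, sub_apply, smul_apply, one_apply_eq_self,
      InnerProductSpace.rankOne_apply, inner_sub_left, inner_add_left, real_inner_smul_left, hA,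
      real_inner_self_eq_norm_sq v, hv, ha v hσv, ← hb, ← hr_def, ← hc_def]
    field_simp
    ring
  have hpos : ((A - Phi p J : Sym d) : E d →L[ℝ] E d).IsPositive := by
    refine ContinuousLinearMap.isPositive_def'.2 ⟨(A - Phi p J).2, fun w => ?_⟩
    obtain ⟨v, s, hv, rfl⟩ : ∃ v s, inner ℝ (σ : E d) v = 0 ∧ w = v + s • (σ : E d) :=
      ⟨_, _, inner_tangential σ w, (tangential_add σ w).symm⟩
    have hΦ := inner_Phi p J v (by rw [hpt]; exact hv) s
    obtain ⟨h1, h2⟩ := jet_forms_of_unit hunit v hv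
    rw [h1, h2, hpt, hval] at hΦ
    have hAσ : inner ℝ ((A : E d →L[ℝ] E d) (σ : E d)) v =
        inner ℝ b v - (p - 1) * fderiv ℝ φ (σ : E d) v := by rw [hA, hb]; ring
    have hAσσ : inner ℝ ((A : E d →L[ℝ] E d) (σ : E d)) (σ : E d) =
        c + (p - 2) * (p - 1) * r := by rw [hA, hc_def]; ring
    have hsq : inner ℝ (((A - Phi p J : Sym d) : E d →L[ℝ] E d) (v + s • (σ : E d)))
        (v + s • (σ : E d)) = c⁻¹ * (inner ℝ b v + c * s) ^ 2 := by
      rw [AddSubgroupClass.coe_sub, sub_apply, inner_sub_left, hΦ]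
      simp only [AddSubgroupClass.coe_sub, AddMemClass.coe_add, selfAdjoint.val_smul,
        selfAdjoint.val_one, symProd, add_apply, sub_apply, smul_apply, one_apply_eq_self,
        InnerProductSpace.rankOne_apply, map_add, map_smul, inner_sub_left, inner_add_left,
        inner_add_right, real_inner_smul_left, real_inner_smul_right,
        Sym.inner_comm A v (σ : E d), hAσ, hAσσ]
      field_simp
      ring
    change 0 ≤ inner ℝ (((A - Phi p J : Sym d) : E d →L[ℝ] E d) (v + s • (σ : E d)))
        (v + s • (σ : E d))
    rw [hsq]
    positivity
  have := hF.positivity _ hJF _ hpos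
  rwa [add_sub_cancel] at this

/-- The perturbation preserves the contact at `σ` and raises only the radial entry of the second
derivative, making the radial inequality strict. -/
theorem snd_fderiv_add_sq {φ : E d → ℝ} {σ : S d} (hφ : ContDiffAt ℝ 2 φ (σ : E d)) (ε : ℝ)
    (v w : E d) :
    fderiv ℝ (fderiv ℝ fun x => φ x + ε * (inner ℝ (σ : E d) x - 1) ^ 2) (σ : E d) v w =
      fderiv ℝ (fderiv ℝ φ) (σ : E d) v w +
        2 * ε * (inner ℝ (σ : E d) v * inner ℝ (σ : E d) w) := by
  have hℓ : ∀ x : E d, HasFDerivAt (fun x : E d => inner ℝ (σ : E d) x - 1)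
      (innerSL ℝ (σ : E d)) x := fun x => (innerSL ℝ (σ : E d)).hasFDerivAt.sub_const 1
  have h1 : fderiv ℝ (fun x => φ x + ε * (inner ℝ (σ : E d) x - 1) ^ 2) =ᶠ[𝓝 (σ : E d)]
      fun x => fderiv ℝ φ x + (2 * ε * (inner ℝ (σ : E d) x - 1)) • innerSL ℝ (σ : E d) := by
    filter_upwards [hφ.eventually (by simp)] with x hx
    refine (((hx.differentiableAt (by simp)).hasFDerivAt.add
      (((hℓ x).pow 2).const_mul ε)).fderiv).trans ?_
    ext y
    simp
    ring
  have h2 : ContDiffAt ℝ 1 (fderiv ℝ φ) (σ : E d) := hφ.fderiv_right (by norm_num)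
  have h3 := (h2.differentiableAt (by simp)).hasFDerivAt.add
    (((hℓ σ).const_mul (2 * ε)).smul_const (innerSL ℝ (σ : E d)))
  rw [h1.fderiv_eq]
  refine (congrArg (fun L : E d →L[ℝ] E d →L[ℝ] ℝ => L v w) h3.fderiv).trans ?_
  simp
  ring

theorem mem_of_touching {p : ℝ} {F : Set (Sym d)} (hF : IsConeSubequation F)
    {u : E d → EReal} {g : S d → EReal}
    (hom : ∀ t : ℝ, 0 < t → ∀ τ : S d, u (t • (τ : E d)) = ((t ^ (2 - p) : ℝ) : EReal) * g τ)
    (hg : IsSphereSubharmonic (onSphere p F) g) {σ : S d} {φ : E d → ℝ}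
    (hφ : ContDiffAt ℝ 2 φ (σ : E d)) (hle : ∀ᶠ y in 𝓝 (σ : E d), u y ≤ (φ y : EReal))
    (heq : u σ = (φ σ : EReal)) {A : Sym d}
    (hA : ∀ v w, inner ℝ ((A : E d →L[ℝ] E d) v) w = fderiv ℝ (fderiv ℝ φ) (σ : E d) v w) :
    A ∈ F := by
  obtain ⟨-, hc⟩ := radial_derivs_of_le hφ (radial_le_of_touching hom hle heq)
  have hmem : ∀ ε : ℝ, 0 < ε → A + (2 * ε) • lineProj σ ∈ F := by
    intro ε hε
    have hsm : ContDiff ℝ 2 fun x : E d => ε * (inner ℝ (σ : E d) x - 1) ^ 2 :=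
      contDiff_const.mul (((contDiff_const.inner ℝ contDiff_id).sub contDiff_const).pow 2)
    refine mem_of_touching_of_lt hF hom hg
      (φ := fun x => φ x + ε * (inner ℝ (σ : E d) x - 1) ^ 2) (hφ.add hsm.contDiffAt) ?_ ?_ ?_ ?_
    · filter_upwards [hle] with y hy
      refine hy.trans (EReal.coe_le_coe_iff.2 ?_)
      have : 0 ≤ ε * (inner ℝ (σ : E d) y - 1) ^ 2 := by positivity
      linarith
    · rw [heq, inner_pt_pt]
      simp
    · rw [snd_fderiv_add_sq hφ, inner_pt_pt]
      linarith
    · intro v w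
      rw [snd_fderiv_add_sq hφ, ← hA]
      simp only [lineProj, AddMemClass.coe_add, selfAdjoint.val_smul, add_apply, smul_apply,
        InnerProductSpace.rankOne_apply, inner_add_left, real_inner_smul_left]
  have hcont : Continuous fun ε : ℝ => A + (2 * ε) • lineProj σ := by
    refine continuous_induced_rng.2 ?_
    simp only [Function.comp_def, AddMemClass.coe_add, selfAdjoint.val_smul]
    fun_prop
  have hlim : Filter.Tendsto (fun ε : ℝ => A + (2 * ε) • lineProj σ) (𝓝[>] 0) (𝓝 A) := by
    have h0 : A + (2 * 0 : ℝ) • lineProj σ = A := by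
      refine Subtype.ext (ContinuousLinearMap.ext fun w => ?_)
      change (A : E d →L[ℝ] E d) w + (2 * 0 : ℝ) • (lineProj σ : E d →L[ℝ] E d) w = _
      rw [mul_zero, zero_smul, add_zero]
    have h := (hcont.tendsto 0).mono_left (nhdsWithin_le_nhds (s := Set.Ioi 0))
    rwa [h0] at h
  -- The perturbed forms `A + 2ε P_σ` lie in `F` and tend to `A` as `ε ↓ 0`.
  exact hF.isClosed.mem_of_tendsto hlim
    (Filter.eventually_of_mem self_mem_nhdsWithin fun ε hε => hmem ε hε)

/-! ### Transfer between `u` and `g`. -/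

theorem norm_smul_radial (σ : S d) {x : E d} (hx : x ≠ 0) : ‖x‖ • (radial σ x : E d) = x := by
  rw [coe_radial σ hx, smul_smul, mul_inv_cancel₀ (norm_ne_zero_iff.2 hx), one_smul]

theorem apply_eq_of_homogeneous {p : ℝ} {u : E d → EReal} {g : S d → EReal}
    (hom : ∀ t : ℝ, 0 < t → ∀ τ : S d, u (t • (τ : E d)) = ((t ^ (2 - p) : ℝ) : EReal) * g τ)
    (σ : S d) {x : E d} (hx : x ≠ 0) : u x = ((‖x‖ ^ (2 - p) : ℝ) : EReal) * g (radial σ x) := by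
  rw [← hom ‖x‖ (norm_pos_iff.2 hx), norm_smul_radial σ hx]

theorem apply_smul_of_homogeneous {p : ℝ} {u : E d → EReal} {g : S d → EReal}
    (hom : ∀ t : ℝ, 0 < t → ∀ τ : S d, u (t • (τ : E d)) = ((t ^ (2 - p) : ℝ) : EReal) * g τ)
    {t : ℝ} (ht : 0 < t) {x : E d} (hx : x ≠ 0) :
    u (t • x) = ((t ^ (2 - p) : ℝ) : EReal) * u x := by
  have hn := norm_pos_iff.2 hx
  rw [apply_eq_of_homogeneous hom (radialProj x hx) hx, ← mul_assoc, ← EReal.coe_mul,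
    ← Real.mul_rpow ht.le hn.le, ← hom _ (mul_pos ht hn), mul_smul, norm_smul_radial _ hx]

theorem upperSemicontinuous_of_homogeneous {p : ℝ} {u : E d → EReal} {g : S d → EReal}
    (hom : ∀ t : ℝ, 0 < t → ∀ τ : S d, u (t • (τ : E d)) = ((t ^ (2 - p) : ℝ) : EReal) * g τ)
    (hu : UpperSemicontinuousOn u {0}ᶜ) : UpperSemicontinuous g := by
  intro τ y hy
  have hy' : u τ < y := by rwa [eq_of_homogeneous hom]
  have h := hu τ (pt_ne_zero τ) y hy'
  rw [isOpen_compl_singleton.nhdsWithin_eq (pt_ne_zero τ)] at h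
  filter_upwards [continuous_subtype_val.continuousAt.eventually h] with τ' h'
  rwa [eq_of_homogeneous hom] at h'

theorem upperSemicontinuousOn_of_homogeneous {p : ℝ} {u : E d → EReal} {g : S d → EReal}
    (hom : ∀ t : ℝ, 0 < t → ∀ τ : S d, u (t • (τ : E d)) = ((t ^ (2 - p) : ℝ) : EReal) * g τ)
    (hg : UpperSemicontinuous g) : UpperSemicontinuousOn u {0}ᶜ := by
  intro x hx y hy
  replace hx : x ≠ 0 := hx
  let σ := radialProj x hx
  have hn : ∀ z : E d, z ≠ 0 → 0 < ‖z‖ ^ (2 - p) := fun z hz =>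
    Real.rpow_pos_of_pos (norm_pos_iff.2 hz) _
  -- A real intermediate bound gives a real upper bound for `g` near the direction of `x`, so only a
  -- continuous real majorant of `u` has to be compared with `y`; the value `-∞` needs no separate
  -- treatment.
  obtain ⟨m, hm1, hm2⟩ := EReal.lt_iff_exists_real_btwn.1 hy
  have hlt : g (radial σ x) < (((‖x‖ ^ (2 - p))⁻¹ * m : ℝ) : EReal) := by
    by_contra! hle
    have h := mul_le_mul_of_nonneg_left hle (EReal.coe_nonneg.2 (hn x hx).le)
    rw [← EReal.coe_mul, mul_inv_cancel_left₀ (hn x hx).ne',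
      ← apply_eq_of_homogeneous hom σ hx] at h
    exact absurd hm1 h.not_gt
  have hcont : ContinuousAt (fun z : E d =>
      ((‖z‖ ^ (2 - p) * ((‖x‖ ^ (2 - p))⁻¹ * m) : ℝ) : EReal)) x := by
    refine continuous_coe_real_ereal.continuousAt.comp ?_
    exact (continuous_norm.continuousAt.rpow_const (Or.inl (norm_ne_zero_iff.2 hx))).mul
      continuousAt_const
  have hxy : ((‖x‖ ^ (2 - p) * ((‖x‖ ^ (2 - p))⁻¹ * m) : ℝ) : EReal) < y := by
    rwa [mul_inv_cancel_left₀ (hn x hx).ne']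
  have h1 := hcont.tendsto.eventually_lt_const hxy
  have h2 := (continuousAt_radial σ hx).eventually (hg (radial σ x) _ hlt)
  refine Filter.Eventually.filter_mono nhdsWithin_le_nhds ?_
  filter_upwards [h1, h2, isOpen_ne.mem_nhds hx] with z hz1 hz2 hz
  rw [apply_eq_of_homogeneous hom σ hz]
  refine lt_of_le_of_lt ?_ hz1
  rw [EReal.coe_mul]
  exact mul_le_mul_of_nonneg_left hz2.le (EReal.coe_nonneg.2 (hn z hz).le)

theorem coe_mul_ne_top {c : ℝ} (hc : 0 < c) {z : EReal} (hz : z ≠ ⊤) : (c : EReal) * z ≠ ⊤ := by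
  induction z with
  | bot => simp [EReal.coe_mul_bot_of_pos hc]
  | coe r => rw [← EReal.coe_mul]; exact EReal.coe_ne_top _
  | top => exact absurd rfl hz

theorem isSphereSubharmonic_of_isSubharmonicOn {p : ℝ} {F : Set (Sym d)}
    {u : E d → EReal} {g : S d → EReal}
    (hom : ∀ t : ℝ, 0 < t → ∀ τ : S d, u (t • (τ : E d)) = ((t ^ (2 - p) : ℝ) : EReal) * g τ)
    (hu : IsSubharmonicOn F {0}ᶜ u) : IsSphereSubharmonic (onSphere p F) g := by
  refine ⟨upperSemicontinuous_of_homogeneous hom hu.1, fun σ => ?_, fun σ ψ hψ hle heq => ?_⟩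
  · rw [← eq_of_homogeneous hom]
    exact hu.2.1 _ (pt_ne_zero σ)
  have hσ := pt_ne_zero σ
  -- The extension has the same homogeneity as `u`, so contact on the sphere spreads to contact near
  -- `σ` in space.
  let φ : E d → ℝ := fun x => ‖x‖ ^ (2 - p) * ψ (radial σ x)
  have hφψ : ∀ τ : S d, φ τ = ψ τ := fun τ => by simp [φ, radial_coe]
  have hφ : ContDiffAt ℝ 2 φ (σ : E d) := by
    refine ((contDiffAt_norm ℝ hσ).rpow_const_of_ne (norm_ne_zero_iff.2 hσ)).mul ?_
    refine ContMDiffAt.contDiffAt ?_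
    refine ContMDiffAt.comp (g := ψ) (f := radial σ) (σ : E d) ?_ (contMDiffAt_radial σ hσ)
    rwa [radial_coe]
  have hφhom : ∀ t : ℝ, 0 < t → ∀ x ≠ 0, φ (t • x) = t ^ (2 - p) * φ x := by
    intro t ht x hx
    have hr : radial σ (t • x) = radial σ x := by
      conv_lhs => rw [← norm_smul_radial σ hx, smul_smul]
      exact radial_smul _ _ (mul_pos ht (norm_pos_iff.2 hx))
    simp only [φ]
    rw [hr, norm_smul, Real.norm_of_nonneg ht.le, Real.mul_rpow ht.le (norm_nonneg x), mul_assoc]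
  have hle' : ∀ᶠ y in 𝓝 (σ : E d), u y ≤ (φ y : EReal) := by
    have ht := (continuousAt_radial σ hσ).tendsto
    rw [radial_coe] at ht
    filter_upwards [ht.eventually hle, isOpen_ne.mem_nhds hσ] with y hy hy0
    rw [apply_eq_of_homogeneous hom σ hy0, EReal.coe_mul]
    exact mul_le_mul_of_nonneg_left hy
      (EReal.coe_nonneg.2 (Real.rpow_nonneg (norm_nonneg y) _))
  obtain ⟨A, hAF, hA⟩ := hu.2.2 σ hσ φ hφ hle' (by rw [eq_of_homogeneous hom, heq, hφψ])
  obtain ⟨J, hJA, hJ⟩ := exists_isTwoJetAt hφ hφψ hφhom hA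
  exact ⟨J, by rwa [onSphere, Set.mem_preimage, hJA], hJ⟩

theorem isSubharmonicOn_of_isSphereSubharmonic {p : ℝ} {F : Set (Sym d)}
    (hF : IsConeSubequation F) {u : E d → EReal} {g : S d → EReal}
    (hom : ∀ t : ℝ, 0 < t → ∀ τ : S d, u (t • (τ : E d)) = ((t ^ (2 - p) : ℝ) : EReal) * g τ)
    (hg : IsSphereSubharmonic (onSphere p F) g) : IsSubharmonicOn F {0}ᶜ u := by
  refine ⟨upperSemicontinuousOn_of_homogeneous hom hg.1, fun x hx => ?_,
    fun x hx φ hφ hle heq => ?_⟩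
  · replace hx : x ≠ 0 := hx
    rw [apply_eq_of_homogeneous hom (radialProj x hx) hx]
    exact coe_mul_ne_top (Real.rpow_pos_of_pos (norm_pos_iff.2 hx) _) (hg.2.1 _)
  replace hx : x ≠ 0 := hx
  obtain ⟨A, hA⟩ := exists_sym_of_bilin _ (snd_fderiv_comm hφ)
  refine ⟨A, ?_, hA⟩
  set R := ‖x‖ with hR_def
  have hR : 0 < R := norm_pos_iff.2 hx
  let σ := radialProj x hx
  have hRσ : R • (σ : E d) = x := by
    have h := norm_smul_radial σ hx
    rwa [radial_of_ne σ hx] at h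
  have hsc : ContDiffAt ℝ 2 (fun y => φ (R • y)) (σ : E d) :=
    ContDiffAt.comp (g := φ) (f := fun y : E d => R • y) (σ : E d) (by rwa [hRσ])
      (contDiff_const_smul R).contDiffAt
  have hRR : ((R ^ (p - 2) : ℝ) : EReal) * ((R ^ (2 - p) : ℝ) : EReal) = 1 := by
    rw [← EReal.coe_mul, ← Real.rpow_add hR]
    simp
  have hu : ∀ y : E d, y ≠ 0 → u y = ((R ^ (p - 2) : ℝ) : EReal) * u (R • y) := fun y hy => by
    rw [apply_smul_of_homogeneous hom hR hy, ← mul_assoc, hRR, one_mul]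
  -- By homogeneity of `u`, the function `R^(p-2) φ(R ·)` touches `u` at `σ`. The chain rule
  -- multiplies the second derivative by `R²`, and the cone property later removes the positive
  -- factor.
  have hmem : (R ^ (p - 2) * (R * R)) • A ∈ F := by
    refine mem_of_touching hF hom hg (σ := σ) (φ := fun y => R ^ (p - 2) * φ (R • y))
      (contDiffAt_const.mul hsc) ?_ ?_ ?_
    · have ht : Filter.Tendsto (fun y : E d => R • y) (𝓝 (σ : E d)) (𝓝 x) := by
        rw [← hRσ]
        exact (continuous_const_smul R).tendsto _
      filter_upwards [ht.eventually hle, isOpen_ne.mem_nhds (pt_ne_zero σ)] with y hy hy0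
      rw [hu y hy0, EReal.coe_mul]
      exact mul_le_mul_of_nonneg_left hy (EReal.coe_nonneg.2 (Real.rpow_nonneg hR.le _))
    · rw [hu _ (pt_ne_zero σ), hRσ, heq, EReal.coe_mul]
    · intro v w
      have h1 : fderiv ℝ (fun y => R ^ (p - 2) * φ (R • y)) =ᶠ[𝓝 (σ : E d)]
          fun y => (R ^ (p - 2) * R) • fderiv ℝ φ (R • y) := by
        filter_upwards [hsc.eventually (by simp)] with y hy
        rw [fderiv_const_mul (hy.differentiableAt (by simp)), fderiv_comp_smul, smul_smul]
      have h2 : ContDiffAt ℝ 1 (fderiv ℝ φ) (R • (σ : E d)) := by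
        rw [hRσ]
        exact hφ.fderiv_right (by norm_num)
      have h3 : DifferentiableAt ℝ (fun y => fderiv ℝ φ (R • y)) (σ : E d) :=
        (h2.differentiableAt (by simp)).comp (f := fun y : E d => R • y) (σ : E d)
          ((differentiable_id.const_smul R) _)
      rw [h1.fderiv_eq, fderiv_fun_const_smul h3, fderiv_comp_smul, hRσ]
      simp only [selfAdjoint.val_smul, smul_apply, real_inner_smul_left, hA, smul_eq_mul]
      ring
  have hpos : 0 < R ^ (p - 2) * (R * R) := by positivity
  have h := hF.cone _ hmem _ (inv_pos.2 hpos)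
  rwa [inv_smul_smul₀ hpos.ne'] at h

theorem isSubharmonicOn_iff {p : ℝ} {F : Set (Sym d)} (hF : IsConeSubequation F)
    {u : E d → EReal} {g : S d → EReal}
    (hom : ∀ t : ℝ, 0 < t → ∀ τ : S d, u (t • (τ : E d)) = ((t ^ (2 - p) : ℝ) : EReal) * g τ) :
    IsSubharmonicOn F {0}ᶜ u ↔ IsSphereSubharmonic (onSphere p F) g :=
  ⟨isSphereSubharmonic_of_isSubharmonicOn hom, isSubharmonicOn_of_isSphereSubharmonic hF hom⟩

theorem IsSphereSubharmonic.mono {G G' : Set (SphereJet d)} (h : G ⊆ G') {g : S d → EReal}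
    (hg : IsSphereSubharmonic G g) : IsSphereSubharmonic G' g :=
  ⟨hg.1, hg.2.1, fun σ ψ hψ hle heq =>
    let ⟨J, hJ, hJ'⟩ := hg.2.2 σ ψ hψ hle heq
    ⟨J, h hJ, hJ'⟩⟩

end HomogeneousSubharmonics

theorem theorem5p5 (d : ℕ) (p : ℝ) (hp : p ≠ 2) (F : Set (Sym d)) (hF : IsConeSubequation F)
    (u : E d → EReal) (g : S d → EReal)
    (hu : UpperSemicontinuousOn u {0}ᶜ) (hu_top : ∀ x ≠ 0, u x ≠ ⊤)
    (hg : UpperSemicontinuous g) (hg_top : ∀ σ, g σ ≠ ⊤)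
    (hug : ∀ (x : E d) (hx : x ≠ 0),
      u x = ((‖x‖ ^ (2 - p) : ℝ) : EReal) * g (radialProj x hx)) :
    (IsSubharmonicOn F {0}ᶜ u ↔ IsSphereSubharmonic (onSphere p F) g) ∧
    (IsHarmonicOn F {0}ᶜ u ↔
      (IsSphereSubharmonic (onSphere p F) g ∧
        IsSphereSubharmonic (onSphere p (dual F)) (fun σ => -g σ))) ∧
    (IsSphereHarmonic (onSphere p F) g → IsHarmonicOn F {0}ᶜ u) ∧
    (p ≠ 1 → (IsHarmonicOn F {0}ᶜ u ↔ IsSphereHarmonic (onSphere p F) g)) := by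
  have hom : ∀ t : ℝ, 0 < t → ∀ τ : S d,
      u (t • (τ : E d)) = ((t ^ (2 - p) : ℝ) : EReal) * g τ := by
    intro t ht τ
    have h0 : t • (τ : E d) ≠ 0 := smul_ne_zero ht.ne' (pt_ne_zero τ)
    rw [hug _ h0, ← radial_of_ne τ h0, radial_smul τ τ ht, norm_smul, Real.norm_of_nonneg ht.le,
      norm_eq_of_mem_sphere, mul_one]
  have hom_neg : ∀ t : ℝ, 0 < t → ∀ τ : S d,
      -u (t • (τ : E d)) = ((t ^ (2 - p) : ℝ) : EReal) * -g τ := fun t ht τ => by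
    rw [hom t ht, mul_neg]
  have h1 := isSubharmonicOn_iff hF hom
  have h2 : IsHarmonicOn F {0}ᶜ u ↔ (IsSphereSubharmonic (onSphere p F) g ∧
      IsSphereSubharmonic (onSphere p (dual F)) (fun σ => -g σ)) :=
    and_congr h1 (isSubharmonicOn_iff (u := fun x => -u x) hF.dual hom_neg)
  -- For every `p` the dual taken on the sphere lies in the pullback of the dual; the converse needs
  -- the equality of the two.
  refine ⟨h1, h2, fun h => h2.2 ⟨h.1, h.2.mono (jetDual_onSphere_subset p F)⟩, fun hp1 => ?_⟩
  rw [h2, IsSphereHarmonic, jetDual_onSphere hp1 hp]
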